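/- For a finite simple graph $G$, the distinguishing index $D'(G)$ is the least integer $d$ such that $G$ has an edge labeling (not necessarily a proper edge colouring) with $d$ labels for which the identity is the only automorphism of $G$ preserving the labels of all edges. The strong product $G\boxtimes H$ has vertex set $V(G)\times V(H)$, two distinct vertices $(g,h)$ and $(g',h')$ being adjacent if and only if ($g=g'$ or $gg'\in E(G)$) and ($h=h'$ or $hh'\in E(H)$). Let $P_n$ and $C_n$ denote the path and the cycle with $n$ vertices. Then: (i) $D'(P_m\boxtimes P_n)=2$ for all $m,n\ge 2$ with $(m,n)\ne(2,2)$, and $D'(P_2\boxtimes P_2)=3$; (ii) $D'(C_m\boxtimes C_n)=2$ for all $m,n\ge 3$; (iii) $D'(P_m\boxtimes C_n)=2$ for all $m\ge 2$ and $n\ge 3$. -/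

import Mathlib

namespace SimpleGraph

/-- The direct product of two graphs: `(g, h)` and `(g', h')` are adjacent precisely if
`g, g'` are adjacent in `G` and `h, h'` are adjacent in `H`. -/
def directProd {V W : Type*} (G : SimpleGraph V) (H : SimpleGraph W) : SimpleGraph (V × W) where
  Adj x y := G.Adj x.1 y.1 ∧ H.Adj x.2 y.2
  symm := ⟨fun _ _ h => ⟨h.1.symm, h.2.symm⟩⟩
  loopless := ⟨fun _ h => G.irrefl h.1⟩

/-- The strong product of two graphs: its edge set is the union of the edge sets of the
Cartesian (box) product and of the direct product. -/
def strongProd {V W : Type*} (G : SimpleGraph V) (H : SimpleGraph W) : SimpleGraph (V × W) :=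
  G.boxProd H ⊔ G.directProd H

/-- Two vertices of the strong product are adjacent iff they are distinct and, in each
coordinate, equal or adjacent. -/
theorem strongProd_adj {V W : Type*} (G : SimpleGraph V) (H : SimpleGraph W) (x y : V × W) :
    (G.strongProd H).Adj x y ↔
      x ≠ y ∧ (x.1 = y.1 ∨ G.Adj x.1 y.1) ∧ (x.2 = y.2 ∨ H.Adj x.2 y.2) := by
  obtain ⟨a, b⟩ := x
  obtain ⟨c, d⟩ := y
  have hG : G.Adj a c → a ≠ c := fun h => h.ne
  have hH : H.Adj b d → b ≠ d := fun h => h.ne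
  simp only [strongProd, directProd, sup_adj, boxProd_adj, ne_eq, Prod.mk.injEq]
  tauto

/-- An edge labeling (an arbitrary, not necessarily proper, edge colouring) is distinguishing
if the only automorphism of the graph that preserves the labels of all edges is the identity. -/
def IsDistinguishingEdgeLabeling {V L : Type*} (G : SimpleGraph V) (c : G.edgeSet → L) : Prop :=
  ∀ σ : G ≃g G, (∀ e : G.edgeSet, c (σ.mapEdgeSet e) = c e) → ∀ v : V, σ v = v

/-- The distinguishing index `D'(G)`: the least `d` such that `G` has a distinguishing edge
labeling with `d` labels. If there is no such `d`, the value is `⊤`. -/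
noncomputable def distinguishingIndex {V : Type*} (G : SimpleGraph V) : ℕ∞ :=
  ⨅ d ∈ {d : ℕ | ∃ c : G.edgeSet → Fin d, G.IsDistinguishingEdgeLabeling c}, (d : ℕ∞)

end SimpleGraph

/-!
If a nontrivial automorphism exists, one label is not enough. Two labels are enough as soon as the
graph has an asymmetric spanning subgraph: an automorphism preserving membership of edges in
the subgraph is an automorphism of the subgraph. For `P_m ⊠ P_n`, and hence for every product
containing it as a spanning subgraph, take the boustrophedon Hamiltonian path of the grid together
with the diagonal `{a, a + 2}`, `a = n - 2`, which cuts off the corner `a + 1` at the first turn.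
The triangle so created splits the path into two tails. If `n ≥ 3`, which may be assumed by
exchanging the factors, both tails are nonempty and the second is longer, so no automorphism
reverses the path, and one that fixes its starting vertex fixes every vertex in turn.

The product `P_2 ⊠ P_2` is `K_4`, where a labelling with two labels is just a graph on four
vertices. Such a graph is never asymmetric: two of its vertices have the same degree, and
interchanging them, possibly together with the other two, is an automorphism. With three labels,
give two adjacent edges their own labels.
-/

section

open SimpleGraph

variable {V W : Type*}

/-- A graph is asymmetric if the identity is its only automorphism; equivalently, the
constant edge labeling is distinguishing. -/
def IsAsymmetric (G : SimpleGraph V) : Prop :=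
  ∀ σ : G ≃g G, ∀ v, σ v = v

theorem IsAsymmetric.of_iso {G : SimpleGraph V} {H : SimpleGraph W} (hH : IsAsymmetric H)
    (e : G ≃g H) : IsAsymmetric G := fun σ v => by
  simpa using hH ((e.symm.trans σ).trans e) (e v)

theorem not_isAsymmetric_of_perm {G : SimpleGraph V} (σ : Equiv.Perm V)
    (hσ : ∀ x y, G.Adj (σ x) (σ y) ↔ G.Adj x y) {v : V} (hv : σ v ≠ v) : ¬ IsAsymmetric G :=
  fun hG => hv (hG ⟨σ, hσ _ _⟩ v)

theorem iso_apply_eq_self_of_adj {G : SimpleGraph V} {σ : G ≃g G} {v w : V} (hv : σ v = v)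
    (hvw : G.Adj v w) (h : ∀ u, G.Adj v u → u ≠ w → σ u = u) : σ w = w := by
  by_contra hne
  have hadj : G.Adj v (σ w) := by simpa only [hv] using σ.map_adj_iff.2 hvw
  exact hne (σ.injective (h (σ w) hadj hne))

theorem distinguishingIndex_eq_of_isLeast {G : SimpleGraph V} {k : ℕ}
    (hk : IsLeast {d : ℕ | ∃ c : G.edgeSet → Fin d, G.IsDistinguishingEdgeLabeling c} k) :
    G.distinguishingIndex = k :=
  le_antisymm (iInf₂_le k hk.1) (le_iInf₂ fun _ hd => Nat.cast_le.2 (hk.2 hd))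

theorem two_le_of_isDistinguishingEdgeLabeling {G : SimpleGraph V} (hG : ¬ IsAsymmetric G)
    {d : ℕ} {c : G.edgeSet → Fin d} (hc : G.IsDistinguishingEdgeLabeling c) : 2 ≤ d := by
  by_contra! hd
  have : Subsingleton (Fin d) := Fin.subsingleton_iff_le_one.2 (by lia)
  exact hG fun σ => hc σ fun _ => Subsingleton.elim _ _

theorem exists_isDistinguishingEdgeLabeling_of_isAsymmetric_le {G H : SimpleGraph V}
    (hle : H ≤ G) (hH : IsAsymmetric H) :
    ∃ c : G.edgeSet → Fin 2, G.IsDistinguishingEdgeLabeling c := by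
  classical
  refine ⟨fun e => if e.1 ∈ H.edgeSet then 1 else 0, fun σ hσ => ?_⟩
  have hadj (x y : V) : H.Adj (σ x) (σ y) ↔ H.Adj x y := by
    by_cases hxy : G.Adj x y
    · have hlabel : (if H.Adj (σ x) (σ y) then (1 : Fin 2) else 0) = if H.Adj x y then 1 else 0 :=
        hσ ⟨s(x, y), hxy⟩
      split_ifs at hlabel <;> simp_all
    · exact iff_of_false (fun h => hxy (σ.map_adj_iff.1 (hle h))) fun h => hxy (hle h)
  exact hH ⟨σ.toEquiv, hadj _ _⟩

theorem distinguishingIndex_eq_two {G H : SimpleGraph V} (hG : ¬ IsAsymmetric G) (hle : H ≤ G)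
    (hH : IsAsymmetric H) : G.distinguishingIndex = 2 :=
  distinguishingIndex_eq_of_isLeast
    ⟨exists_isDistinguishingEdgeLabeling_of_isAsymmetric_le hle hH,
      fun _ ⟨_, hc⟩ => two_le_of_isDistinguishingEdgeLabeling hG hc⟩

/-- The path `0, 1, …, N - 1` with the extra edge joining `a` to `a + 2`. If `a + 2 ≥ N` the
chord is absent and the graph is the plain path. -/
def chordedPath (N a : ℕ) : SimpleGraph (Fin N) where
  Adj i j := (i : ℕ) + 1 = j ∨ (j : ℕ) + 1 = i ∨
    ((i : ℕ) = a ∧ (j : ℕ) = a + 2) ∨ ((j : ℕ) = a ∧ (i : ℕ) = a + 2)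
  symm := ⟨fun _ _ h => by lia⟩
  loopless := ⟨fun _ h => by lia⟩

theorem chordedPath_adj {N a : ℕ} {i j : Fin N} :
    (chordedPath N a).Adj i j ↔ (i : ℕ) + 1 = j ∨ (j : ℕ) + 1 = i ∨
      ((i : ℕ) = a ∧ (j : ℕ) = a + 2) ∨ ((j : ℕ) = a ∧ (i : ℕ) = a + 2) :=
  Iff.rfl

namespace chordedPath

variable {N a : ℕ}

theorem eq_zero_or_eq_last_of_subsingleton_neighborSet {i : Fin N}
    (h : ((chordedPath N a).neighborSet i).Subsingleton) : (i : ℕ) = 0 ∨ (i : ℕ) + 1 = N := by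
  by_contra! hi
  have hpred : (chordedPath N a).Adj i ⟨i - 1, by lia⟩ := .inr (.inl (by simp only; lia))
  have hsucc : (chordedPath N a).Adj i ⟨i + 1, by lia⟩ := .inl rfl
  have heq := Fin.val_eq_of_eq (h hpred hsucc)
  simp only at heq
  lia

theorem apply_zero_eq_zero_or_last (ha : 1 ≤ a) (hN : 0 < N)
    (σ : chordedPath N a ≃g chordedPath N a) :
    (σ ⟨0, hN⟩ : ℕ) = 0 ∨ (σ ⟨0, hN⟩ : ℕ) + 1 = N := by
  have hzero : ((chordedPath N a).neighborSet ⟨0, hN⟩).Subsingleton := fun x hx y hy => by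
    simp only [mem_neighborSet, chordedPath] at hx hy
    lia
  refine eq_zero_or_eq_last_of_subsingleton_neighborSet (a := a) fun x hx y hy => ?_
  refine σ.symm.injective (hzero ?_ ?_) <;>
    rwa [mem_neighborSet, ← σ.map_adj_iff, σ.apply_symm_apply]

theorem apply_add_eq_of_apply_zero_eq_last (hN : 2 * a + 3 < N)
    {σ : chordedPath N a ≃g chordedPath N a} (h : (σ ⟨0, by lia⟩ : ℕ) + 1 = N) (i : ℕ)
    (hi : i ≤ a) : (σ ⟨i, by lia⟩ : ℕ) + i + 1 = N := by
  induction i using Nat.twoStepInduction with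
  | zero => exact h
  | one =>
    have hadj := (σ.map_adj_iff (v := ⟨0, by lia⟩) (w := ⟨1, by lia⟩)).2 (.inl rfl)
    rw [chordedPath_adj] at hadj
    omega
  | more i ih ih' =>
    have hadj := (σ.map_adj_iff (v := ⟨i + 1, by lia⟩) (w := ⟨i + 2, by lia⟩)).2 (.inl rfl)
    have hne : (σ ⟨i + 2, by lia⟩ : ℕ) ≠ σ ⟨i, by lia⟩ :=
      Fin.val_injective.ne (σ.injective.ne (by simp))
    rw [chordedPath_adj] at hadj
    specialize ih (by lia)
    specialize ih' (by lia)
    omega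

theorem apply_zero_ne_last (hN : 2 * a + 3 < N) (σ : chordedPath N a ≃g chordedPath N a) :
    (σ ⟨0, by lia⟩ : ℕ) + 1 ≠ N := by
  intro h
  have ha := apply_add_eq_of_apply_zero_eq_last hN h a le_rfl
  have hadj₁ := (σ.map_adj_iff (v := ⟨a, by lia⟩) (w := ⟨a + 1, by lia⟩)).2 (.inl rfl)
  have hadj₂ := (σ.map_adj_iff (v := ⟨a + 1, by lia⟩) (w := ⟨a + 2, by lia⟩)).2 (.inl rfl)
  have hadj₃ := (σ.map_adj_iff (v := ⟨a, by lia⟩) (w := ⟨a + 2, by lia⟩)).2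
    (.inr (.inr (.inl ⟨rfl, rfl⟩)))
  rw [chordedPath_adj] at hadj₁ hadj₂ hadj₃
  omega

theorem apply_succ_eq_self (ha : 1 ≤ a) (hN : a + 3 < N) {σ : chordedPath N a ≃g chordedPath N a}
    (hpred : σ ⟨a - 1, by lia⟩ = ⟨a - 1, by lia⟩) (hself : σ ⟨a, by lia⟩ = ⟨a, by lia⟩) :
    σ ⟨a + 1, by lia⟩ = ⟨a + 1, by lia⟩ := by
  have hadj₁ := (σ.map_adj_iff (v := ⟨a, by lia⟩) (w := ⟨a + 1, by lia⟩)).2 (.inl rfl)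
  have hadj₂ := (σ.map_adj_iff (v := ⟨a, by lia⟩) (w := ⟨a + 2, by lia⟩)).2
    (.inr (.inr (.inl ⟨rfl, rfl⟩)))
  have hadj₃ := (σ.map_adj_iff (v := ⟨a + 2, by lia⟩) (w := ⟨a + 3, by lia⟩)).2 (.inl rfl)
  -- `σ` cannot swap `a + 1` and `a + 2`: only the latter has a neighbour off the triangle.
  have hne (i j : Fin N) (hij : (i : ℕ) ≠ j) : (σ i : ℕ) ≠ σ j :=
    Fin.val_injective.ne (σ.injective.ne (Fin.val_ne_iff.1 hij))
  have h₁ := hne ⟨a + 1, by lia⟩ ⟨a - 1, by lia⟩ (by simp only; lia)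
  have h₂ := hne ⟨a + 2, by lia⟩ ⟨a - 1, by lia⟩ (by simp only; lia)
  have h₃ := hne ⟨a + 2, by lia⟩ ⟨a + 1, by lia⟩ (by simp)
  have h₄ := hne ⟨a + 3, by lia⟩ ⟨a + 1, by lia⟩ (by simp)
  have h₅ := hne ⟨a + 3, by lia⟩ ⟨a, by lia⟩ (by simp)
  rw [chordedPath_adj] at hadj₁ hadj₂ hadj₃
  rw [hpred] at h₁ h₂
  rw [hself] at hadj₁ hadj₂ h₅
  simp only [Fin.ext_iff] at hadj₁ hadj₂ h₁ h₂ h₅ ⊢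
  omega

theorem apply_eq_self_of_apply_zero (ha : 1 ≤ a) (hN : a + 3 < N)
    {σ : chordedPath N a ≃g chordedPath N a} (h : (σ ⟨0, by lia⟩ : ℕ) = 0) (i : Fin N) :
    σ i = i := by
  obtain ⟨i, hi⟩ := i
  induction i using Nat.strong_induction_on with | _ i ih
  obtain rfl | rfl | ⟨hi0, hia⟩ : i = 0 ∨ i = a + 1 ∨ (i ≠ 0 ∧ i ≠ a + 1) := by tauto
  · exact Fin.ext h
  · exact apply_succ_eq_self ha hN (ih _ (by lia) _) (ih _ (by lia) _)
  · refine iso_apply_eq_self_of_adj (ih (i - 1) (by lia) (by lia)) ?_ fun u hu hne => ih u ?_ u.2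
    · rw [chordedPath_adj]
      lia
    · rw [Ne, Fin.ext_iff] at hne
      rw [chordedPath_adj] at hu
      simp only at hu hne
      omega

theorem isAsymmetric (ha : 1 ≤ a) (hN : 2 * a + 3 < N) : IsAsymmetric (chordedPath N a) :=
  fun σ => apply_eq_self_of_apply_zero ha (by lia) <|
    (apply_zero_eq_zero_or_last ha (by lia) σ).resolve_right (apply_zero_ne_last hN σ)

end chordedPath

/-- The boustrophedon numbering of the `m × n` grid: rows are read in order, the even ones from
left to right and the odd ones from right to left, so that consecutive cells are neighbours. -/
def snakeEquiv (m n : ℕ) : Fin m × Fin n ≃ Fin (m * n) :=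
  (Equiv.prodShear (Equiv.refl _) fun r : Fin m =>
    if Even (r : ℕ) then Equiv.refl _ else Fin.revPerm).trans finProdFinEquiv

namespace snakeEquiv

theorem val_apply {m n : ℕ} (x : Fin m × Fin n) :
    (snakeEquiv m n x : ℕ) = n * x.1 + if Even (x.1 : ℕ) then (x.2 : ℕ) else (x.2.rev : ℕ) := by
  rw [add_comm]
  by_cases hr : Even (x.1 : ℕ) <;> simp [snakeEquiv, hr]

end snakeEquiv

theorem eq_or_eq_succ_of_mul_add_succ_eq {n r c r' c' : ℕ} (hc : c < n) (hc' : c' < n)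
    (h : n * r + c + 1 = n * r' + c') :
    (r = r' ∧ c + 1 = c') ∨ (r + 1 = r' ∧ c + 1 = n ∧ c' = 0) := by
  obtain hr | rfl | hr := lt_trichotomy r r'
  · obtain ⟨k, rfl⟩ := Nat.exists_eq_add_of_le (Nat.succ_le_of_lt hr)
    obtain rfl | hk := Nat.eq_zero_or_pos k
    · lia
    · nlinarith
  · lia
  · nlinarith

namespace snakeEquiv

theorem strongProd_pathGraph_adj_of_succ_eq {m n : ℕ} {x y : Fin m × Fin n}
    (h : (snakeEquiv m n x : ℕ) + 1 = snakeEquiv m n y) :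
    ((pathGraph m).strongProd (pathGraph n)).Adj x y := by
  have hne : x ≠ y := by
    rintro rfl
    lia
  rw [val_apply, val_apply] at h
  have hcol (z : Fin m × Fin n) : (if Even (z.1 : ℕ) then (z.2 : ℕ) else (z.2.rev : ℕ)) < n := by
    split_ifs <;> exact Fin.is_lt _
  rw [strongProd_adj, pathGraph_adj, pathGraph_adj, Fin.ext_iff, Fin.ext_iff]
  refine ⟨hne, ?_⟩
  obtain ⟨hr, hc⟩ | ⟨hr, hc, hc'⟩ :=
    eq_or_eq_succ_of_mul_add_succ_eq (hcol x) (hcol y) h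
  · rw [hr] at hc
    simp only [Fin.val_rev] at hc
    split_ifs at hc <;> omega
  · simp only [← hr, Nat.even_add_one, Fin.val_rev] at hc hc'
    split_ifs at hc hc' <;> omega

theorem strongProd_pathGraph_adj_of_eq_of_eq_add_two {m a : ℕ} {x y : Fin m × Fin (a + 2)}
    (hx : (snakeEquiv m (a + 2) x : ℕ) = a) (hy : (snakeEquiv m (a + 2) y : ℕ) = a + 2) :
    ((pathGraph m).strongProd (pathGraph (a + 2))).Adj x y := by
  have hm : 1 < m := by
    refine lt_of_mul_lt_mul_right (a := a + 2) ?_ (Nat.zero_le _)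
    simpa only [one_mul, hy] using (snakeEquiv m (a + 2) y).is_lt
  have hx' : x = (⟨0, by lia⟩, ⟨a, by lia⟩) :=
    (snakeEquiv m (a + 2)).injective (Fin.ext (by rw [hx, val_apply]; simp))
  have hy' : y = (⟨1, hm⟩, ⟨a + 1, by lia⟩) :=
    (snakeEquiv m (a + 2)).injective (Fin.ext (by rw [hy, val_apply]; simp))
  simp [strongProd_adj, pathGraph_adj, hx', hy']

theorem comap_chordedPath_le (m a : ℕ) :
    (chordedPath (m * (a + 2)) a).comap (snakeEquiv m (a + 2)) ≤
      (pathGraph m).strongProd (pathGraph (a + 2)) := by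
  intro x y hxy
  rw [comap_adj, chordedPath_adj] at hxy
  obtain h | h | ⟨hx, hy⟩ | ⟨hy, hx⟩ := hxy
  · exact strongProd_pathGraph_adj_of_succ_eq h
  · exact (strongProd_pathGraph_adj_of_succ_eq h).symm
  · exact strongProd_pathGraph_adj_of_eq_of_eq_add_two hx hy
  · exact (strongProd_pathGraph_adj_of_eq_of_eq_add_two hy hx).symm

end snakeEquiv

theorem strongProd_mono {G G' : SimpleGraph V} {H H' : SimpleGraph W} (hG : G ≤ G')
    (hH : H ≤ H') : G.strongProd H ≤ G'.strongProd H' := by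
  intro x y h
  rw [strongProd_adj] at h ⊢
  exact ⟨h.1, h.2.1.imp_right (@hG _ _), h.2.2.imp_right (@hH _ _)⟩

/-- The strong product is commutative up to isomorphism. -/
def strongProdComm (G : SimpleGraph V) (H : SimpleGraph W) :
    G.strongProd H ≃g H.strongProd G where
  toEquiv := Equiv.prodComm V W
  map_rel_iff' {x y} := by
    rw [strongProd_adj, strongProd_adj]
    exact and_congr (Equiv.prodComm V W).injective.ne_iff and_comm

theorem exists_isAsymmetric_le_of_iso {G : SimpleGraph V} {G' : SimpleGraph W} (e : G ≃g G')
    (h : ∃ K ≤ G', IsAsymmetric K) : ∃ K ≤ G, IsAsymmetric K := by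
  obtain ⟨K, hle, hK⟩ := h
  exact ⟨K.comap e, fun _ _ hxy => e.map_adj_iff.1 (hle hxy), hK.of_iso (Iso.comap e.toEquiv K)⟩

theorem exists_isAsymmetric_le_strongProd_pathGraph_of_three_le {m n : ℕ} (hm : 2 ≤ m)
    (hn : 3 ≤ n) : ∃ K ≤ (pathGraph m).strongProd (pathGraph n), IsAsymmetric K := by
  obtain ⟨a, rfl⟩ := Nat.exists_eq_add_of_le' (show 2 ≤ n by lia)
  have hsize : 2 * (a + 2) ≤ m * (a + 2) := Nat.mul_le_mul_right _ hm
  exact ⟨_, snakeEquiv.comap_chordedPath_le m a,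
    (chordedPath.isAsymmetric (by lia) (by lia)).of_iso (Iso.comap (snakeEquiv m (a + 2)) _)⟩

theorem exists_isAsymmetric_le_strongProd_pathGraph {m n : ℕ} (hm : 2 ≤ m) (hn : 2 ≤ n)
    (hmn : ¬ (m = 2 ∧ n = 2)) :
    ∃ K ≤ (pathGraph m).strongProd (pathGraph n), IsAsymmetric K := by
  obtain hn3 | hm3 : 3 ≤ n ∨ 3 ≤ m := by lia
  · exact exists_isAsymmetric_le_strongProd_pathGraph_of_three_le hm hn3
  · exact exists_isAsymmetric_le_of_iso (strongProdComm _ _)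
      (exists_isAsymmetric_le_strongProd_pathGraph_of_three_le hn hm3)

theorem not_isAsymmetric_strongProd_left [Nonempty W] {G : SimpleGraph V}
    (hG : ¬ IsAsymmetric G) (H : SimpleGraph W) : ¬ IsAsymmetric (G.strongProd H) := by
  simp only [IsAsymmetric, not_forall] at hG
  obtain ⟨φ, v, hv⟩ := hG
  refine not_isAsymmetric_of_perm (φ.toEquiv.prodCongr (Equiv.refl W)) (fun x y => ?_)
    (v := (v, Classical.arbitrary W)) fun h => hv (congrArg Prod.fst h)
  simp [strongProd_adj, Prod.ext_iff, φ.map_adj_iff]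

theorem revPerm_zero_ne_zero {n : ℕ} (hn : 2 ≤ n) :
    Fin.revPerm (⟨0, by lia⟩ : Fin n) ≠ ⟨0, by lia⟩ := by
  rw [Fin.revPerm_apply, Ne, Fin.ext_iff, Fin.val_rev]
  lia

theorem not_isAsymmetric_pathGraph {n : ℕ} (hn : 2 ≤ n) : ¬ IsAsymmetric (pathGraph n) := by
  refine not_isAsymmetric_of_perm Fin.revPerm (fun i j => ?_) (revPerm_zero_ne_zero hn)
  simp only [pathGraph_adj, Fin.revPerm_apply, Fin.val_rev]
  lia

theorem not_isAsymmetric_cycleGraph {n : ℕ} (hn : 2 ≤ n) : ¬ IsAsymmetric (cycleGraph n) := by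
  refine not_isAsymmetric_of_perm Fin.revPerm (fun i j => ?_) (revPerm_zero_ne_zero hn)
  have hsub (k l : Fin n) : (k.rev - l.rev : Fin n) = l - k := by
    ext
    simp only [Fin.val_sub, Fin.val_rev]
    congr 1
    lia
  simp only [cycleGraph_adj', Fin.revPerm_apply, hsub, or_comm]

theorem distinguishingIndex_strongProd_eq_two {m n : ℕ} (hm : 2 ≤ m) (hn : 2 ≤ n)
    (hmn : ¬ (m = 2 ∧ n = 2)) {G : SimpleGraph (Fin m)} {H : SimpleGraph (Fin n)}
    (hG : pathGraph m ≤ G) (hH : pathGraph n ≤ H) (hsymm : ¬ IsAsymmetric G) :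
    (G.strongProd H).distinguishingIndex = 2 := by
  have : Nonempty (Fin n) := ⟨⟨0, by lia⟩⟩
  obtain ⟨K, hle, hK⟩ := exists_isAsymmetric_le_strongProd_pathGraph hm hn hmn
  exact distinguishingIndex_eq_two (not_isAsymmetric_strongProd_left hsymm H)
    (hle.trans (strongProd_mono hG hH)) hK

theorem exists_ne_degree_eq [Fintype V] [Nontrivial V] (G : SimpleGraph V) [DecidableRel G.Adj] :
    ∃ u v, u ≠ v ∧ G.degree u = G.degree v := by
  by_contra! hne
  have hinj : Function.Injective fun v => (⟨G.degree v, G.degree_lt_card_verts v⟩ : Fin _) :=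
    fun u v huv => by_contra fun h => hne u v h (Fin.val_eq_of_eq huv)
  have hsurj := ((Fintype.bijective_iff_injective_and_card _).2 ⟨hinj, by simp⟩).surjective
  have hcard : 1 < Fintype.card V := Fintype.one_lt_card
  obtain ⟨u, hu⟩ := hsurj ⟨0, by lia⟩
  obtain ⟨v, hv⟩ := hsurj ⟨Fintype.card V - 1, by lia⟩
  rw [Fin.mk.injEq] at hu hv
  have huv : u ≠ v := by
    rintro rfl
    lia
  exact (degree_eq_zero G u).1 hu v ((degree_eq_card_sub_one G v).1 hv huv.symm).symm

theorem not_isAsymmetric_of_adj_iff {G : SimpleGraph V} {u v : V} (huv : u ≠ v)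
    (h : ∀ x, x ≠ u → x ≠ v → (G.Adj u x ↔ G.Adj v x)) : ¬ IsAsymmetric G := by
  classical
  refine not_isAsymmetric_of_perm (Equiv.swap u v) (fun x y => ?_) (v := u) ?_
  · grind [G.adj_comm, G.irrefl]
  · rw [Equiv.swap_apply_left]
    exact huv.symm

theorem not_isAsymmetric_of_adj_iff_of_adj_iff {G : SimpleGraph V} {u v w x : V}
    (hnodup : [u, v, w, x].Nodup) (hV : ∀ y, y ∈ [u, v, w, x])
    (h : G.Adj u w ↔ G.Adj v x) (h' : G.Adj u x ↔ G.Adj v w) : ¬ IsAsymmetric G := by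
  classical
  simp only [List.mem_cons, List.not_mem_nil, or_false] at hV
  refine not_isAsymmetric_of_perm (Equiv.swap u v * Equiv.swap w x) (fun y z => ?_) (v := u) ?_
  · obtain rfl | rfl | rfl | rfl := hV y <;> obtain rfl | rfl | rfl | rfl := hV z <;>
      grind [G.adj_comm, G.irrefl, Equiv.Perm.mul_apply]
  · grind [Equiv.Perm.mul_apply]

theorem exists_nodup_forall_mem_of_card_eq_four [Fintype V] (hV : Fintype.card V = 4) {u v : V}
    (huv : u ≠ v) : ∃ w x, [u, v, w, x].Nodup ∧ ∀ y, y ∈ [u, v, w, x] := by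
  classical
  obtain ⟨w, x, hwx, h⟩ := Finset.card_eq_two.1
    (show ({u, v}ᶜ : Finset V).card = 2 by rw [Finset.card_compl, hV, Finset.card_pair huv])
  have hmem (y : V) : (y ≠ u ∧ y ≠ v) ↔ y = w ∨ y = x := by simpa using Finset.ext_iff.1 h y
  refine ⟨w, x, ?_, fun y => ?_⟩
  · have hw := (hmem w).2 (.inl rfl)
    have hx := (hmem x).2 (.inr rfl)
    simp only [List.nodup_cons, List.mem_cons, List.not_mem_nil, or_false, not_or]
    grind
  · have := hmem y
    simp only [List.mem_cons, List.not_mem_nil, or_false]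
    tauto

theorem adj_iff_or_adj_iff_of_degree_eq [Fintype V] {G : SimpleGraph V} [DecidableRel G.Adj]
    {u v w x : V} (hnodup : [u, v, w, x].Nodup) (hV : ∀ y, y ∈ [u, v, w, x])
    (hdeg : G.degree u = G.degree v) :
    ((G.Adj u w ↔ G.Adj v w) ∧ (G.Adj u x ↔ G.Adj v x)) ∨
      ((G.Adj u w ↔ G.Adj v x) ∧ (G.Adj u x ↔ G.Adj v w)) := by
  classical
  have hdegree (y : V) :
      G.degree y = ([u, v, w, x].map fun z => if G.Adj y z then 1 else 0).sum := by
    rw [← List.sum_toFinset _ hnodup, Finset.eq_univ_of_forall fun z => List.mem_toFinset.2 (hV z),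
      ← Finset.card_filter, ← G.card_neighborFinset_eq_degree, G.neighborFinset_eq_filter]
  simp only [hdegree, List.map_cons, List.map_nil, List.sum_cons, List.sum_nil, G.irrefl,
    G.adj_comm v u, if_false] at hdeg
  grind

theorem not_isAsymmetric_of_card_eq_four [Fintype V] (hV : Fintype.card V = 4)
    (G : SimpleGraph V) : ¬ IsAsymmetric G := by
  classical
  have : Nontrivial V := Fintype.one_lt_card_iff_nontrivial.1 (by lia)
  obtain ⟨u, v, huv, hdeg⟩ := exists_ne_degree_eq G
  obtain ⟨w, x, hnodup, hmem⟩ := exists_nodup_forall_mem_of_card_eq_four hV huv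
  obtain ⟨hw, hx⟩ | ⟨hw, hx⟩ := adj_iff_or_adj_iff_of_degree_eq hnodup hmem hdeg
  · refine not_isAsymmetric_of_adj_iff huv fun y hyu hyv => ?_
    have hy := hmem y
    simp only [List.mem_cons, hyu, hyv, List.not_mem_nil, or_false, false_or] at hy
    obtain rfl | rfl := hy <;> assumption
  · exact not_isAsymmetric_of_adj_iff_of_adj_iff hnodup hmem hw hx

theorem exists_isAsymmetric_of_isDistinguishingEdgeLabeling_top {d : ℕ} (hd : d ≤ 2)
    {c : (⊤ : SimpleGraph V).edgeSet → Fin d}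
    (hc : (⊤ : SimpleGraph V).IsDistinguishingEdgeLabeling c) :
    ∃ G : SimpleGraph V, IsAsymmetric G := by
  let G : SimpleGraph V := fromEdgeSet ((↑) '' {e | (c e : ℕ) = 0})
  refine ⟨G, fun σ => hc (Iso.completeGraph σ.toEquiv) ?_⟩
  have hadj (x y : V) (hxy : (⊤ : SimpleGraph V).Adj x y) :
      G.Adj x y ↔ (c ⟨s(x, y), hxy⟩ : ℕ) = 0 := by
    simp [G, hxy.ne]
  rintro ⟨e, he⟩
  induction e with | _ x y
  have hlabel := σ.map_adj_iff (v := x) (w := y)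
  have hσxy : (⊤ : SimpleGraph V).Adj (σ x) (σ y) := σ.injective.ne he
  rw [hadj _ _ hσxy, hadj _ _ he] at hlabel
  change c ⟨s(σ x, σ y), hσxy⟩ = _
  lia

theorem exists_isDistinguishingEdgeLabeling_of_subsingleton_compl {G : SimpleGraph V} {p q r : V}
    (hpq : G.Adj p q) (hqr : G.Adj q r) (hpr : p ≠ r)
    (hcompl : ({p, q, r}ᶜ : Set V).Subsingleton) :
    ∃ c : G.edgeSet → Fin 3, G.IsDistinguishingEdgeLabeling c := by
  classical
  let label (e : Sym2 V) : Fin 3 := if e = s(p, q) then 1 else if e = s(q, r) then 2 else 0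
  refine ⟨fun e => label e, fun σ hσ => ?_⟩
  have hlabel {x y : V} (hxy : G.Adj x y) : label s(σ x, σ y) = label s(x, y) := hσ ⟨s(x, y), hxy⟩
  have hσpq : s(σ p, σ q) = s(p, q) := by
    have hlabelσ := hlabel hpq
    simp only [label] at hlabelσ
    split_ifs at hlabelσ <;> simp_all
  have hσqr : s(σ q, σ r) = s(q, r) := by
    have hne : s(q, r) ≠ s(p, q) := by
      rw [Sym2.eq_swap, Ne, Sym2.congr_left]
      exact hpr.symm
    have hlabelσ := hlabel hqr
    simp only [label, hne, if_true, if_false] at hlabelσ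
    split_ifs at hlabelσ <;> simp_all
  have hq : σ q = q := by
    have hpq_ne := hpq.ne
    rw [Sym2.eq_iff] at hσpq hσqr
    grind
  rw [hq] at hσpq hσqr
  have hp : σ p = p := Sym2.congr_left.1 hσpq
  have hr : σ r = r := Sym2.congr_right.1 hσqr
  have hfix {v : V} (hv : v ∈ ({p, q, r} : Set V)) : σ v = v := by
    obtain rfl | rfl | rfl := hv <;> assumption
  intro v
  by_cases hv : v ∈ ({p, q, r} : Set V)
  · exact hfix hv
  · exact hcompl (fun hσv => hv (by rwa [σ.injective (hfix hσv)] at hσv)) hv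

theorem strongProd_pathGraph_two : (pathGraph 2).strongProd (pathGraph 2) = ⊤ := by
  ext x y
  simp only [strongProd_adj, pathGraph_adj, top_adj, Fin.ext_iff]
  lia

theorem distinguishingIndex_top_of_card_eq_four [Fintype V] (hV : Fintype.card V = 4) :
    (⊤ : SimpleGraph V).distinguishingIndex = 3 := by
  refine distinguishingIndex_eq_of_isLeast ⟨?_, ?_⟩
  · obtain ⟨u, v, huv⟩ := Fintype.exists_pair_of_one_lt_card (α := V) (by lia)
    obtain ⟨w, x, hnodup, hmem⟩ := exists_nodup_forall_mem_of_card_eq_four hV huv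
    simp only [List.nodup_cons, List.mem_cons, List.not_mem_nil, or_false, not_or] at hnodup hmem
    refine exists_isDistinguishingEdgeLabeling_of_subsingleton_compl (p := u) (q := v) (r := w)
      huv hnodup.2.1.1 hnodup.1.2.1 fun y hy z hz => ?_
    have heq {y : V} (hy : y ∈ ({u, v, w}ᶜ : Set V)) : y = x := by
      simp only [Set.mem_compl_iff, Set.mem_insert_iff, Set.mem_singleton_iff] at hy
      have := hmem y
      tauto
    exact (heq hy).trans (heq hz).symm
  · rintro d ⟨c, hc⟩
    by_contra! hd
    obtain ⟨G, hG⟩ := exists_isAsymmetric_of_isDistinguishingEdgeLabeling_top (by lia) hc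
    exact not_isAsymmetric_of_card_eq_four hV G hG

end

theorem mainTheorem7 :
    (∀ m n : ℕ, 2 ≤ m → 2 ≤ n → ¬ (m = 2 ∧ n = 2) →
      ((SimpleGraph.pathGraph m).strongProd (SimpleGraph.pathGraph n)).distinguishingIndex = 2) ∧
    ((SimpleGraph.pathGraph 2).strongProd (SimpleGraph.pathGraph 2)).distinguishingIndex = 3 ∧
    (∀ m n : ℕ, 3 ≤ m → 3 ≤ n →
      ((SimpleGraph.cycleGraph m).strongProd (SimpleGraph.cycleGraph n)).distinguishingIndex
        = 2) ∧
    (∀ m n : ℕ, 2 ≤ m → 3 ≤ n →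
      ((SimpleGraph.pathGraph m).strongProd (SimpleGraph.cycleGraph n)).distinguishingIndex
        = 2) := by
  refine ⟨fun m n hm hn hmn => ?_, ?_, fun m n hm hn => ?_, fun m n hm hn => ?_⟩
  · exact distinguishingIndex_strongProd_eq_two hm hn hmn le_rfl le_rfl
      (not_isAsymmetric_pathGraph hm)
  · rw [strongProd_pathGraph_two]
    exact distinguishingIndex_top_of_card_eq_four rfl
  · exact distinguishingIndex_strongProd_eq_two (by lia) (by lia) (by lia)
      SimpleGraph.pathGraph_le_cycleGraph SimpleGraph.pathGraph_le_cycleGraph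
      (not_isAsymmetric_cycleGraph (by lia))
  · exact distinguishingIndex_strongProd_eq_two hm (by lia) (by lia)
      le_rfl SimpleGraph.pathGraph_le_cycleGraph (not_isAsymmetric_pathGraph hm)
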